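/- **Theorem 4.1.** Let $\mathcal V$ be a Banach $\mathbb H$-space, that is, a real Banach space with a left and a right multiplication by quaternions (making it a left and a right $\mathbb H$-module) such that every left multiplication $L_{\bf q}x={\bf q}x$ and every right multiplication $R_{\bf q}x=x{\bf q}$ is a bounded real linear operator on $\mathcal V$ and the maps ${\bf q}\mapsto L_{\bf q}$, ${\bf q}\mapsto R_{\bf q}$ are norm continuous. Let $\mathcal V_{\mathbb C}=\mathcal V+i\mathcal V$ be its complexification, a complex Banach space, with conjugation $C(x+iy)=x-iy$ and right multiplications $(x+iy){\bf q}=x{\bf q}+i(y{\bf q})$. Let $\mathcal B^{\rm r}(\mathcal V)$ be the real algebra of all bounded real linear operators on $\mathcal V$ commuting with all $R_{\bf q}$, and $\mathcal B^{\rm r}(\mathcal V_{\mathbb C})$ the complex algebra of all bounded complex linear operators on $\mathcal V_{\mathbb C}$ commuting with all right multiplications by quaternions. For $S\in\mathcal B^{\rm r}(\mathcal V_{\mathbb C})$ put $S^\flat=CSC$. For $T\in\mathcal B^{\rm r}(\mathcal V)$ put $T_{\mathbb C}(x+iy)=Tx+iTy$ and $$\sigma_{\mathbb C}(T)=\{\lambda\in\mathbb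 C:\ T^2-2(\mathrm{Re}\,\lambda)T+|\lambda|^2\ \text{is not invertible in }\mathcal B^{\rm r}(\mathcal V)\}.$$ A Cauchy domain in an open set $U\subset\mathbb C$ is a bounded open set $\Delta$ with $\overline\Delta\subset U$ whose boundary is the union of a finite family $\Gamma$ of closed piecewise smooth (that is, piecewise $C^1$) curves, positively oriented in the sense that the total winding number of $\Gamma$ is $1$ about each point of $\Delta$ and $0$ about each point outside $\overline\Delta$. For an analytic function $F:U\to\mathcal B^{\rm r}(\mathcal V_{\mathbb C})$ and a Cauchy domain $\Delta$ in $U$ with $\sigma(T_{\mathbb C})\subset\Delta$ and boundary $\Gamma$, put $$F(T_{\mathbb C})=\frac1{2\pi i}\int_\Gamma F(\zeta)(\zeta-T_{\mathbb C})^{-1}\,d\zeta .$$ Let $U\subset\mathbb C$ be open and conjugate symmetric (if $\zeta\in U$ then $\bar\zeta\in U$), and let $F:U\to\mathcal B^{\rm r}(\mathcal V_{\mathbb C})$ be analytic with $F(\zeta)^\flat=F(\bar\zeta)$ for all $\zeta\in U$. Then, for every $T\in\mathcal B^{\rm r}(\mathcal V)$ with $\sigma_{\mathbb C}(T)\subset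 U$ and every such Cauchy domain, $F(T_{\mathbb C})$ belongs to $\mathcal B^{\rm r}(\mathcal V_{\mathbb C})$ and $F(T_{\mathbb C})^\flat=F(T_{\mathbb C})$. -/

import Mathlib

open scoped Quaternion

noncomputable section

namespace QuatCalc

/-- The axioms of a Banach `ℍ`-space (completeness is the separate instance `CompleteSpace V`): a
real Banach space which carries a left and a right
multiplication by quaternions (`q • x` and `MulOpposite.op q • x`, written `q x` and `x q`), such
that every left multiplication `L_q` and every right multiplication `R_q` is a bounded real linear
operator and both `q ↦ L_q` and `q ↦ R_q` are norm continuous.  (Being additive and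
continuous, these maps are real linear, so that real scalars act as real quaternions.) -/
class BanachHSpace (V : Type*) [NormedAddCommGroup V] [NormedSpace ℝ V]
    [Module ℍ[ℝ] V] [Module ℍ[ℝ]ᵐᵒᵖ V] : Prop where
  exists_leftMul : ∃ L : ℍ[ℝ] → (V →L[ℝ] V), Continuous L ∧ ∀ q x, L q x = q • x
  exists_rightMul : ∃ R : ℍ[ℝ] → (V →L[ℝ] V), Continuous R ∧
    ∀ q x, R q x = MulOpposite.op q • x

/-- The complexification `V_ℂ = V + iV`; the pair `⟨x, y⟩` stands for `x + iy`. -/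
@[ext]
structure Complexification (V : Type*) where
  re : V
  im : V

namespace Complexification

section Algebra

variable {V : Type*} [AddCommGroup V]

instance : Zero (Complexification V) := ⟨⟨0, 0⟩⟩
instance : Add (Complexification V) := ⟨fun z w => ⟨z.re + w.re, z.im + w.im⟩⟩
instance : Neg (Complexification V) := ⟨fun z => ⟨-z.re, -z.im⟩⟩
instance : Sub (Complexification V) := ⟨fun z w => ⟨z.re - w.re, z.im - w.im⟩⟩

@[simp] theorem re_zero : (0 : Complexification V).re = 0 := rfl
@[simp] theorem im_zero : (0 : Complexification V).im = 0 := rfl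
@[simp] theorem re_add (z w : Complexification V) : (z + w).re = z.re + w.re := rfl
@[simp] theorem im_add (z w : Complexification V) : (z + w).im = z.im + w.im := rfl
@[simp] theorem re_neg (z : Complexification V) : (-z).re = -z.re := rfl
@[simp] theorem im_neg (z : Complexification V) : (-z).im = -z.im := rfl
@[simp] theorem re_sub (z w : Complexification V) : (z - w).re = z.re - w.re := rfl
@[simp] theorem im_sub (z w : Complexification V) : (z - w).im = z.im - w.im := rfl

instance : AddCommGroup (Complexification V) where
  add_assoc a b c := by ext <;> simp [add_assoc]
  zero_add a := by ext <;> simp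
  add_zero a := by ext <;> simp
  add_comm a b := by ext <;> simp [add_comm]
  neg_add_cancel a := by ext <;> simp
  sub_eq_add_neg a b := by ext <;> simp [sub_eq_add_neg]
  nsmul := nsmulRec
  zsmul := zsmulRec

variable [Module ℝ V]

instance : SMul ℂ (Complexification V) :=
  ⟨fun c z => ⟨c.re • z.re - c.im • z.im, c.re • z.im + c.im • z.re⟩⟩

@[simp] theorem re_smul (c : ℂ) (z : Complexification V) :
    (c • z).re = c.re • z.re - c.im • z.im := rfl
@[simp] theorem im_smul (c : ℂ) (z : Complexification V) :
    (c • z).im = c.re • z.im + c.im • z.re := rfl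

instance : Module ℂ (Complexification V) where
  one_smul z := by ext <;> simp
  mul_smul a b z := by
    ext
    · simp; module
    · simp; module
  smul_zero a := by ext <;> simp
  smul_add a z w := by
    ext
    · simp; module
    · simp; module
  add_smul a b z := by
    ext
    · simp; module
    · simp; module
  zero_smul z := by ext <;> simp

end Algebra

section Norm

variable {V : Type*} [NormedAddCommGroup V] [NormedSpace ℝ V]

/-- For `z = x + iy`, the real linear map `ℂ → V`, `w ↦ Re (w z) = (Re w) x - (Im w) y`. -/
def toCLM (z : Complexification V) : ℂ →L[ℝ] V :=
  Complex.reCLM.smulRight z.re - Complex.imCLM.smulRight z.im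

@[simp] theorem toCLM_apply (z : Complexification V) (w : ℂ) :
    z.toCLM w = w.re • z.re - w.im • z.im := rfl

/-- `toCLM` as an additive homomorphism. -/
def toCLMHom : Complexification V →+ (ℂ →L[ℝ] V) where
  toFun := toCLM
  map_zero' := by ext w; simp
  map_add' z w := by
    refine ContinuousLinearMap.ext fun c => ?_
    simp; module

theorem toCLMHom_injective : Function.Injective (toCLMHom (V := V)) := by
  intro z w h
  have h1 := DFunLike.congr_fun h (1 : ℂ)
  have h2 := DFunLike.congr_fun h Complex.I
  simp only [toCLMHom, AddMonoidHom.coe_mk, ZeroHom.coe_mk, toCLM_apply] at h1 h2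
  ext
  · simpa using h1
  · simpa using h2

/-- The complex Banach space norm `‖x + iy‖ = sup {‖Re (w (x + iy))‖ : |w| ≤ 1}` of `V_ℂ`; it
induces the product topology of `V + iV`. -/
instance : NormedAddCommGroup (Complexification V) :=
  NormedAddCommGroup.induced _ _ toCLMHom toCLMHom_injective

theorem norm_def (z : Complexification V) : ‖z‖ = ‖z.toCLM‖ := rfl

theorem norm_re_le (z : Complexification V) : ‖z.re‖ ≤ ‖z‖ := by
  simpa [norm_def] using z.toCLM.le_opNorm 1

theorem norm_im_le (z : Complexification V) : ‖z.im‖ ≤ ‖z‖ := by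
  simpa [norm_def] using z.toCLM.le_opNorm Complex.I

theorem norm_le_add (z : Complexification V) : ‖z‖ ≤ ‖z.re‖ + ‖z.im‖ := by
  refine ContinuousLinearMap.opNorm_le_bound z.toCLM (by positivity) fun w => ?_
  rw [toCLM_apply, add_mul]
  refine (norm_sub_le _ _).trans ?_
  rw [norm_smul, norm_smul, mul_comm ‖z.re‖, mul_comm ‖z.im‖]
  have h1 : ‖w.re‖ ≤ ‖w‖ := Complex.abs_re_le_norm w
  have h2 : ‖w.im‖ ≤ ‖w‖ := Complex.abs_im_le_norm w
  gcongr

instance : NormedSpace ℂ (Complexification V) where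
  norm_smul_le c z := by
    refine ContinuousLinearMap.opNorm_le_bound (c • z).toCLM (by positivity) fun w => ?_
    have h : (c • z).toCLM w = z.toCLM (c * w) := by
      simp; module
    rw [h]
    refine (z.toCLM.le_opNorm _).trans (le_of_eq ?_)
    rw [norm_mul, norm_def]; ring

instance [CompleteSpace V] : CompleteSpace (Complexification V) := by
  refine Metric.complete_of_cauchySeq_tendsto fun u hu => ?_
  have hre : CauchySeq fun n => (u n).re := by
    rw [Metric.cauchySeq_iff] at hu ⊢
    intro ε hε
    obtain ⟨N, hN⟩ := hu ε hε
    refine ⟨N, fun m hm n hn => lt_of_le_of_lt ?_ (hN m hm n hn)⟩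
    rw [dist_eq_norm, dist_eq_norm]
    exact norm_re_le (u m - u n)
  have him : CauchySeq fun n => (u n).im := by
    rw [Metric.cauchySeq_iff] at hu ⊢
    intro ε hε
    obtain ⟨N, hN⟩ := hu ε hε
    refine ⟨N, fun m hm n hn => lt_of_le_of_lt ?_ (hN m hm n hn)⟩
    rw [dist_eq_norm, dist_eq_norm]
    exact norm_im_le (u m - u n)
  obtain ⟨x, hx⟩ := cauchySeq_tendsto_of_complete hre
  obtain ⟨y, hy⟩ := cauchySeq_tendsto_of_complete him
  refine ⟨⟨x, y⟩, ?_⟩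
  rw [tendsto_iff_norm_sub_tendsto_zero] at hx hy ⊢
  refine squeeze_zero (fun _ => norm_nonneg _) (fun n => norm_le_add _) ?_
  simpa using hx.add hy

/-- The conjugation `C : x + iy ↦ x - iy` of `V_ℂ`, a conjugate-linear map. -/
def conj : Complexification V →SL[starRingEnd ℂ] Complexification V :=
  LinearMap.mkContinuous
    { toFun := fun z => ⟨z.re, -z.im⟩
      map_add' := fun z w => by ext <;> simp [add_comm]
      map_smul' := fun c z => by ext <;> simp [add_comm] }
    1 fun z => by
      rw [one_mul]
      refine ContinuousLinearMap.opNorm_le_bound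
        (⟨z.re, -z.im⟩ : Complexification V).toCLM (norm_nonneg z) fun w => ?_
      have h := z.toCLM.le_opNorm (starRingEnd ℂ w)
      rw [RCLike.norm_conj] at h
      simpa [norm_def] using h

@[simp] theorem conj_apply (z : Complexification V) : conj z = ⟨z.re, -z.im⟩ := rfl

end Norm

end Complexification

section Operators

variable {V : Type*} [NormedAddCommGroup V] [NormedSpace ℝ V]

/-- The extension `T_ℂ (x + iy) = T x + i T y` of a bounded real linear operator `T`. -/
def complexify (T : V →L[ℝ] V) : Complexification V →L[ℂ] Complexification V :=
  LinearMap.mkContinuous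
    { toFun := fun z => ⟨T z.re, T z.im⟩
      map_add' := fun z w => by ext <;> simp
      map_smul' := fun c z => by ext <;> simp }
    ‖T‖ fun z => by
      refine ContinuousLinearMap.opNorm_le_bound
        (⟨T z.re, T z.im⟩ : Complexification V).toCLM (by positivity) fun w => ?_
      have h : (⟨T z.re, T z.im⟩ : Complexification V).toCLM w = T (z.toCLM w) := by simp
      have h2 := (T.le_opNorm (z.toCLM w)).trans
        (mul_le_mul_of_nonneg_left (z.toCLM.le_opNorm w) (norm_nonneg T))
      rw [← mul_assoc] at h2
      rw [h]
      exact h2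

@[simp] theorem complexify_apply (T : V →L[ℝ] V) (z : Complexification V) :
    complexify T z = ⟨T z.re, T z.im⟩ := rfl

/-- `S♭ = C S C`. -/
def flat (S : Complexification V →L[ℂ] Complexification V) :
    Complexification V →L[ℂ] Complexification V :=
  Complexification.conj.comp (S.comp Complexification.conj)

variable [Module ℍ[ℝ]ᵐᵒᵖ V]

/-- Right multiplication by a quaternion on `V_ℂ`: `(x + iy) q = x q + i (y q)`. -/
def Complexification.rightMul (q : ℍ[ℝ]) (z : Complexification V) : Complexification V :=
  ⟨MulOpposite.op q • z.re, MulOpposite.op q • z.im⟩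

variable (V) [Module ℍ[ℝ] V] [BanachHSpace V]

theorem op_smul_real_smul (q : ℍ[ℝ]) (r : ℝ) (x : V) :
    MulOpposite.op q • r • x = r • MulOpposite.op q • x := by
  obtain ⟨R, -, hR⟩ := BanachHSpace.exists_rightMul (V := V)
  rw [← hR, ← hR, map_smul]

/-- The real algebra `B^r(V)` of bounded right `ℍ`-linear operators on `V`. -/
def rightLinearOps : Subalgebra ℝ (V →L[ℝ] V) where
  carrier := {T | ∀ (q : ℍ[ℝ]) (x : V), T (MulOpposite.op q • x) = MulOpposite.op q • T x}
  mul_mem' {S T} hS hT q x := by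
    simp only [Set.mem_ofPred_eq] at hS hT
    simp [hS, hT]
  add_mem' {S T} hS hT q x := by
    simp only [Set.mem_ofPred_eq] at hS hT
    simp [hS, hT]
  algebraMap_mem' r q x := by
    simp [Algebra.algebraMap_eq_smul_one, op_smul_real_smul V q r x]

/-- The complex algebra `B^r(V_ℂ)` of bounded complex linear operators on `V_ℂ` which commute
with all right multiplications `R_q`, `q ∈ ℍ`. -/
def rightLinearOpsC :
    Subalgebra ℂ (Complexification V →L[ℂ] Complexification V) where
  carrier := {S | ∀ (q : ℍ[ℝ]) (z : Complexification V), S (z.rightMul q) = (S z).rightMul q}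
  mul_mem' {S T} hS hT q z := by
    simp only [Set.mem_ofPred_eq] at hS hT
    simp [hS, hT]
  add_mem' {S T} hS hT q z := by
    simp only [Set.mem_ofPred_eq] at hS hT
    simp only [add_apply, hS, hT]
    ext <;> simp [Complexification.rightMul]
  algebraMap_mem' c q z := by
    simp only [Algebra.algebraMap_eq_smul_one, smul_apply,
      one_apply_eq_self]
    ext <;> simp [Complexification.rightMul, op_smul_real_smul V, smul_sub]

variable {V}

/-- The complex spectrum `σ_ℂ(T)` of `T ∈ B^r(V)`: the set of `λ ∈ ℂ` for which
`T² - 2 (Re λ) T + |λ|²` is not invertible in `B^r(V)`. -/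
def complexSpectrum (T : rightLinearOps V) : Set ℂ :=
  {l : ℂ | ¬ IsUnit (T ^ 2 - (2 * l.re) • T + (‖l‖ ^ 2) • (1 : rightLinearOps V))}

end Operators

section Contours

/-- `γ : [0, 1] → ℂ` is a closed, continuous, piecewise continuously differentiable curve (only
the values of `γ` on `[0, 1]` matter). -/
def IsClosedPiecewiseC1 (γ : ℝ → ℂ) : Prop :=
  ContinuousOn γ (Set.Icc 0 1) ∧ γ 0 = γ 1 ∧
    ∃ (n : ℕ) (t : Fin (n + 1) → ℝ), StrictMono t ∧ t 0 = 0 ∧ t (Fin.last n) = 1 ∧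
      ∀ i : Fin n, ContDiffOn ℝ 1 γ (Set.Icc (t i.castSucc) (t i.succ))

/-- The integral `∫_Γ G(ζ) dζ` along a finite family `Γ` of parametrized curves. -/
def contourIntegral {E : Type*} [NormedAddCommGroup E] [NormedSpace ℂ E] {m : ℕ}
    (Γ : Fin m → ℝ → ℂ) (G : ℂ → E) : E :=
  ∑ j, ∫ t in (0 : ℝ)..1, deriv (Γ j) t • G (Γ j t)

/-- The total winding number `(2πi)⁻¹ ∫_Γ (ζ - z)⁻¹ dζ` of the family `Γ` about `z`. -/
def windingNumber {m : ℕ} (Γ : Fin m → ℝ → ℂ) (z : ℂ) : ℂ :=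
  (2 * Real.pi * Complex.I)⁻¹ * contourIntegral Γ fun ζ => (ζ - z)⁻¹

/-- `Δ` is a Cauchy domain in `U` with boundary `Γ`: a bounded open set with closure in `U` whose
boundary consists of the finite family `Γ` of closed piecewise smooth curves, positively oriented,
that is, winding exactly once around the points of `Δ` and not around those off the closure. -/
structure IsCauchyDomain (U Δ : Set ℂ) {m : ℕ} (Γ : Fin m → ℝ → ℂ) : Prop where
  isOpen : IsOpen Δ
  isBounded : Bornology.IsBounded Δ
  closure_subset : closure Δ ⊆ U
  isClosedPiecewiseC1 : ∀ j, IsClosedPiecewiseC1 (Γ j)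
  frontier_eq : frontier Δ = ⋃ j, Γ j '' Set.Icc 0 1
  winding_inside : ∀ z ∈ Δ, windingNumber Γ z = 1
  winding_outside : ∀ z ∉ closure Δ, windingNumber Γ z = 0

/-- `F(S) = (2πi)⁻¹ ∫_Γ F(ζ) (ζ - S)⁻¹ dζ`, where `(ζ - S)⁻¹` is the inverse in `B(W)`. -/
def rieszDunford {W : Type*} [NormedAddCommGroup W] [NormedSpace ℂ W] {m : ℕ}
    (Γ : Fin m → ℝ → ℂ) (F : ℂ → W →L[ℂ] W) (S : W →L[ℂ] W) : W →L[ℂ] W :=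
  (2 * Real.pi * Complex.I : ℂ)⁻¹ • contourIntegral Γ fun ζ => F ζ * resolvent S ζ

end Contours

end QuatCalc

end

namespace QuatCalc

open MeasureTheory Set Metric Filter Topology

/-! ### Contour integrals along families of rectifiable curves. -/

section Cauchy

variable {E : Type*} [NormedAddCommGroup E] [NormedSpace ℂ E] {m : ℕ}

/-! Write G(ζ) = F(ζ)(ζ - T_ℂ)⁻¹ and let Γ* be the mirror image of Γ in the real axis. The map
`flat` is continuous, conjugate linear and multiplicative, so it passes under the integral and turns
∫_Γ into ∫_Γ*. Since T_ℂ commutes with C, its resolvent has the same symmetry as F, and the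
integrand is again G. The factor (2πi)⁻¹ changes sign under conjugation, so the claim amounts to ∫_Γ
G + ∫_Γ* G = 0 (`IsCauchyDomain.contourIntegral_add_conjCurves`).

The domain Δ need not be conjugate symmetric, so Γ and Γ* may be different sets. Reflection reverses
orientation, however: Γ + Γ* winds 1 - 1 = 0 times about each point of the spectrum and 0 times
about each point off U. Hence it is null-homologous in U \ σ(T_ℂ), where G is holomorphic, and the
homology form of Cauchy's theorem applies. That theorem is proved for Banach-valued functions by
Dixon's argument (`IsRectifiable.contourIntegral_inv_sub_smul_eq_zero`).

Membership in B^r(V_ℂ) holds because this algebra is a commutant, hence stable under inverses and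
integrals. -/

theorem IsClosedPiecewiseC1.intervalIntegrable_deriv {γ : ℝ → ℂ} (h : IsClosedPiecewiseC1 γ) :
    IntervalIntegrable (deriv γ) volume 0 1 := by
  obtain ⟨-, -, n, t, ht, h0, h1, hC⟩ := h
  have key : ∀ i : Fin (n + 1), IntervalIntegrable (deriv γ) volume (t 0) (t i) := by
    intro i
    induction i using Fin.induction with
    | zero => exact IntervalIntegrable.refl
    | succ i ih =>
      refine ih.trans ?_
      have hlt : t i.castSucc < t i.succ := ht (Fin.castSucc_lt_succ)
      -- The derivative within the closed piece is continuous up to the endpoints. It agrees with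
      -- `deriv γ` inside; the break points, where `deriv` may take its default value, form a null
      -- set.
      have hcont := (hC i).continuousOn_derivWithin (uniqueDiffOn_Icc hlt) le_rfl
      refine (hcont.intervalIntegrable_of_Icc hlt.le).congr_uIoo fun x hx => ?_
      rw [uIoo_of_le hlt.le] at hx
      exact derivWithin_of_mem_nhds (Icc_mem_nhds hx.1 hx.2)
  rw [← h0, ← h1]
  exact key _

/-- The trace of a family of curves parametrized by `[0, 1]`. -/
def trace (Γ : Fin m → ℝ → ℂ) : Set ℂ := ⋃ j, Γ j '' Icc 0 1

theorem mem_trace (Γ : Fin m → ℝ → ℂ) (j : Fin m) {t : ℝ} (ht : t ∈ Icc (0 : ℝ) 1) :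
    Γ j t ∈ trace Γ :=
  mem_iUnion.2 ⟨j, t, ht, rfl⟩

/-- A family of continuous curves with integrable derivatives. -/
structure IsRectifiable (Γ : Fin m → ℝ → ℂ) : Prop where
  continuousOn : ∀ j, ContinuousOn (Γ j) (Icc 0 1)
  intervalIntegrable_deriv : ∀ j, IntervalIntegrable (deriv (Γ j)) volume 0 1

theorem IsRectifiable.isCompact_trace {Γ : Fin m → ℝ → ℂ} (hΓ : IsRectifiable Γ) : IsCompact (trace Γ) :=
  isCompact_iUnion fun j => isCompact_Icc.image_of_continuousOn (hΓ.continuousOn j)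

theorem IsRectifiable.continuousOn_comp {X : Type*} [TopologicalSpace X] {Γ : Fin m → ℝ → ℂ}
    (hΓ : IsRectifiable Γ) {g : ℂ → X} (hg : ContinuousOn g (trace Γ)) (j : Fin m) : ContinuousOn (fun t => g (Γ j t)) (Icc 0 1) :=
  hg.comp (hΓ.continuousOn j) fun _ ht => mem_trace Γ j ht

theorem IsRectifiable.intervalIntegrable {Γ : Fin m → ℝ → ℂ} (hΓ : IsRectifiable Γ)
    {g : ℂ → E} (hg : ContinuousOn g (trace Γ)) (j : Fin m) :
    IntervalIntegrable (fun t => deriv (Γ j) t • g (Γ j t)) volume 0 1 :=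
  (hΓ.intervalIntegrable_deriv j).smul_continuousOn
    (by rw [uIcc_of_le zero_le_one]; exact hΓ.continuousOn_comp hg j)

theorem IsRectifiable.contourIntegral_sub {Γ : Fin m → ℝ → ℂ} (hΓ : IsRectifiable Γ)
    {f g : ℂ → E}
    (hf : ContinuousOn f (trace Γ)) (hg : ContinuousOn g (trace Γ)) :
    contourIntegral Γ (fun w => f w - g w) = contourIntegral Γ f - contourIntegral Γ g := by
  simp only [contourIntegral, smul_sub, ← Finset.sum_sub_distrib]
  exact Finset.sum_congr rfl fun j _ =>
    intervalIntegral.integral_sub (hΓ.intervalIntegrable hf j) (hΓ.intervalIntegrable hg j)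

theorem contourIntegral_congr {Γ : Fin m → ℝ → ℂ} {f g : ℂ → E} (h : EqOn f g (trace Γ)) :
    contourIntegral Γ f = contourIntegral Γ g := by
  refine Finset.sum_congr rfl fun j _ => intervalIntegral.integral_congr fun t ht => ?_
  rw [uIcc_of_le zero_le_one] at ht
  simp only [h (mem_trace Γ j ht)]

theorem contourIntegral_smul_const [CompleteSpace E] (Γ : Fin m → ℝ → ℂ) (c : ℂ → ℂ) (x : E) :
    contourIntegral Γ (fun w => c w • x) = contourIntegral Γ c • x := by
  simp only [contourIntegral, Finset.sum_smul, smul_smul, smul_eq_mul,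
    intervalIntegral.integral_smul_const]

theorem contourIntegral_append {n : ℕ} (Γ : Fin m → ℝ → ℂ) (Γ' : Fin n → ℝ → ℂ) (g : ℂ → E) :
    contourIntegral (Fin.append Γ Γ') g = contourIntegral Γ g + contourIntegral Γ' g := by
  simp only [contourIntegral, Fin.sum_univ_add, Fin.append_left, Fin.append_right]

/-- The length of a family of curves. -/
noncomputable def length (Γ : Fin m → ℝ → ℂ) : ℝ := ∑ j, ∫ t in (0 : ℝ)..1, ‖deriv (Γ j) t‖

theorem IsRectifiable.norm_contourIntegral_le {Γ : Fin m → ℝ → ℂ} (hΓ : IsRectifiable Γ)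
    {g : ℂ → E} {C : ℝ} (hg : ∀ w ∈ trace Γ, ‖g w‖ ≤ C) :
    ‖contourIntegral Γ g‖ ≤ length Γ * C := by
  rw [contourIntegral, length, Finset.sum_mul]
  refine (norm_sum_le _ _).trans (Finset.sum_le_sum fun j _ => ?_)
  rw [← intervalIntegral.integral_mul_const]
  refine intervalIntegral.norm_integral_le_of_norm_le zero_le_one
    (ae_of_all _ fun t ht => ?_) ((hΓ.intervalIntegrable_deriv j).norm.mul_const C)
  rw [norm_smul]
  exact mul_le_mul_of_nonneg_left (hg _ (mem_trace Γ j (Ioc_subset_Icc_self ht))) (norm_nonneg _)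

/-- A contour integral of a kernel which depends holomorphically on a parameter and is bounded
locally in the parameter is holomorphic. -/
theorem IsRectifiable.differentiableAt_contourIntegral [CompleteSpace E] {Γ : Fin m → ℝ → ℂ}
    (hΓ : IsRectifiable Γ)
    {k : ℂ → ℂ → E} {z₀ : ℂ} {r M : ℝ} (hr : 0 < r)
    (hd : ∀ w ∈ trace Γ, DifferentiableOn ℂ (fun z => k z w) (ball z₀ r))
    (hc : ∀ z ∈ ball z₀ r, ContinuousOn (k z) (trace Γ))
    (hM : ∀ z ∈ ball z₀ r, ∀ w ∈ trace Γ, ‖k z w‖ ≤ M) :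
    DifferentiableAt ℂ (fun z => contourIntegral Γ (k z)) z₀ := by
  unfold contourIntegral
  refine DifferentiableAt.fun_sum fun j _ => ?_
  have hsub : uIoc (0 : ℝ) 1 ⊆ Icc 0 1 := by
    rw [uIoc_of_le zero_le_one]; exact Ioc_subset_Icc_self
  have hmeas : ∀ z ∈ ball z₀ r, AEStronglyMeasurable (fun t => deriv (Γ j) t • k z (Γ j t))
      (volume.restrict (uIoc 0 1)) := fun z hz =>
    (hΓ.intervalIntegrable (hc z hz) j).def'.aestronglyMeasurable
  have hdiff : ∀ t ∈ uIoc (0 : ℝ) 1, ∀ z ∈ ball z₀ r, HasDerivAt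
      (fun z => deriv (Γ j) t • k z (Γ j t))
      (deriv (Γ j) t • deriv (fun z => k z (Γ j t)) z) z := fun t ht z hz =>
    (((hd _ (mem_trace Γ j (hsub ht))).differentiableAt
      (isOpen_ball.mem_nhds hz)).hasDerivAt).const_smul _
  -- For z within r/2 of z₀, the disc of radius r/4 about z stays in the ball of radius r. Cauchy's
  -- estimate then bounds the z-derivative of the kernel by M / (r/4), which gives the dominating
  -- function.
  have hball : ball z₀ (r / 2) ⊆ ball z₀ r := ball_subset_ball (by linarith)
  refine (intervalIntegral.hasDerivAt_integral_of_dominated_loc_of_deriv_le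
    (F := fun z t => deriv (Γ j) t • k z (Γ j t))
    (F' := fun z t => deriv (Γ j) t • deriv (fun z => k z (Γ j t)) z)
    (bound := fun t => ‖deriv (Γ j) t‖ * (M / (r / 4)))
    (ball_mem_nhds z₀ (half_pos hr)) ?_ ?_ ?_ ?_ ?_ ?_).2.differentiableAt
  · filter_upwards [ball_mem_nhds z₀ hr] with z hz using hmeas z hz
  · exact hΓ.intervalIntegrable (hc z₀ (mem_ball_self hr)) j
  · have hu : Tendsto (fun n : ℕ => (r / 2 / ((n : ℝ) + 1) : ℝ)) atTop (𝓝 0) := by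
      simpa [div_eq_mul_inv] using
        (tendsto_one_div_add_atTop_nhds_zero_nat (𝕜 := ℝ)).const_mul (r / 2)
    have hu0 : ∀ n : ℕ, 0 < r / 2 / ((n : ℝ) + 1) := fun n => by positivity
    have hmem : ∀ n : ℕ, z₀ + ((r / 2 / ((n : ℝ) + 1) : ℝ) : ℂ) ∈ ball z₀ r := fun n => by
      rw [mem_ball, dist_eq_norm, add_sub_cancel_left, Complex.norm_real, Real.norm_of_nonneg
        (hu0 n).le]
      refine (div_le_self (half_pos hr).le ?_).trans_lt (half_lt_self hr)
      linarith [n.cast_nonneg (α := ℝ)]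
    refine aestronglyMeasurable_of_tendsto_ae atTop
      (f := fun (n : ℕ) t => ((r / 2 / ((n : ℝ) + 1) : ℝ) : ℂ)⁻¹ •
        (deriv (Γ j) t • k (z₀ + ((r / 2 / ((n : ℝ) + 1) : ℝ) : ℂ)) (Γ j t)
          - deriv (Γ j) t • k z₀ (Γ j t))) (fun n => ?_) ?_
    · exact ((hmeas _ (hmem n)).sub (hmeas _ (mem_ball_self hr))).const_smul _
    · refine (ae_restrict_iff' measurableSet_uIoc).2 (ae_of_all _ fun t ht => ?_)
      have h1 := (hasDerivAt_iff_tendsto_slope_zero.1 (hdiff t ht z₀ (mem_ball_self hr)))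
      refine h1.comp (tendsto_nhdsWithin_iff.2 ⟨?_, Eventually.of_forall fun n => ?_⟩)
      · exact (Complex.continuous_ofReal.tendsto' 0 0 Complex.ofReal_zero).comp hu
      · exact Complex.ofReal_ne_zero.2 (hu0 n).ne'
  · refine ae_of_all _ fun t ht z hz => ?_
    rw [norm_smul]
    refine mul_le_mul_of_nonneg_left ?_ (norm_nonneg _)
    have hcb : closedBall z (r / 4) ⊆ ball z₀ r := by
      refine closedBall_subset_ball' ?_
      rw [mem_ball] at hz; linarith
    refine Complex.norm_deriv_le_of_forall_mem_sphere_norm_le (by positivity)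
      (DifferentiableOn.diffContOnCl ?_) fun w hw => ?_
    · exact (hd _ (mem_trace Γ j (hsub ht))).mono (closure_ball_subset_closedBall.trans hcb)
    · exact hM w (hcb (sphere_subset_closedBall hw)) _ (mem_trace Γ j (hsub ht))
  · exact (hΓ.intervalIntegrable_deriv j).norm.mul_const _
  · exact ae_of_all _ fun t ht z hz => hdiff t ht z (hball hz)

/-! ### Dixon's proof of the homology form of Cauchy's theorem. -/

/-- The symmetry makes the divided difference holomorphic in its base point as well as in its
argument. -/
theorem dslope_comm (f : ℂ → E) (a b : ℂ) : dslope f a b = dslope f b a := by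
  rcases eq_or_ne a b with rfl | h
  · rfl
  · rw [dslope_of_ne f h, dslope_of_ne f h.symm, slope_comm]

/-- **Cauchy's integral formula, homology version** (Dixon's argument): `f` is holomorphic on the
open set `Ω`, and the winding number of `Γ` vanishes on an open set `W` which is disjoint from
`Γ` and contains the complement of `Ω` as well as a neighbourhood of infinity. -/
theorem IsRectifiable.contourIntegral_inv_sub_smul_eq_zero [CompleteSpace E] {Γ : Fin m → ℝ → ℂ}
    (hΓ : IsRectifiable Γ) {Ω W : Set ℂ} (hΩ : IsOpen Ω) (hW : IsOpen W)
    (hΩW : ∀ z, z ∉ Ω → z ∈ W) (hWb : Bornology.IsBounded Wᶜ) (htr : trace Γ ⊆ Ω)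
    (hWtr : Disjoint W (trace Γ)) (hwind : ∀ z ∈ W, windingNumber Γ z = 0)
    {f : ℂ → E} (hf : DifferentiableOn ℂ f Ω) {z : ℂ} (hz : z ∈ W) :
    contourIntegral Γ (fun w => (w - z)⁻¹ • f w) = 0 := by
  classical
  have hcK := hΓ.isCompact_trace
  obtain ⟨C, hC⟩ := hcK.exists_bound_of_continuousOn (hf.continuousOn.mono htr)
  have hne : ∀ z ∈ W, ∀ w ∈ trace Γ, w - z ≠ 0 := fun z hz w hw h => by
    rw [sub_eq_zero] at h
    exact disjoint_left.1 hWtr hz (h ▸ hw)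
  have hinv : ∀ z ∈ W, ContinuousOn (fun w => (w - z)⁻¹) (trace Γ) := fun z hz =>
    (continuousOn_id.sub continuousOn_const).inv₀ (hne z hz)
  have hcauchy : ∀ z ∈ W, ContinuousOn (fun w => (w - z)⁻¹ • f w) (trace Γ) := fun z hz =>
    (hinv z hz).smul (hf.continuousOn.mono htr)
  -- Dixon's function: the two formulas agree on Ω ∩ W, since there they differ by f z times a
  -- vanishing winding integral. As Ω and W cover the plane, h is entire.
  set h : ℂ → E := fun z => if z ∈ Ω then contourIntegral Γ (dslope f z)
    else contourIntegral Γ (fun w => (w - z)⁻¹ • f w) with h_def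
  have hhΩ : ∀ z ∈ Ω, h z = contourIntegral Γ (dslope f z) := fun z hz => if_pos hz
  have hhW : ∀ z ∈ W, h z = contourIntegral Γ (fun w => (w - z)⁻¹ • f w) := fun z hz => by
    by_cases hzΩ : z ∈ Ω
    · rw [hhΩ z hzΩ]
      have h0 : contourIntegral Γ (fun w => (w - z)⁻¹) = 0 := by
        have := hwind z hz
        rw [windingNumber] at this
        exact (mul_eq_zero.1 this).resolve_left (inv_ne_zero Complex.two_pi_I_ne_zero)
      have h1 : contourIntegral Γ (dslope f z) =
          contourIntegral Γ (fun w => (w - z)⁻¹ • f w - (w - z)⁻¹ • f z) :=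
        contourIntegral_congr fun w hw => by
          rw [dslope_of_ne f (sub_ne_zero.1 (hne z hz w hw)), slope_def_module, smul_sub]
      rw [h1, hΓ.contourIntegral_sub (g := fun w => (w - z)⁻¹ • f z) (hcauchy z hz)
          ((hinv z hz).smul continuousOn_const),
        contourIntegral_smul_const, h0, zero_smul, sub_zero]
    · exact if_neg hzΩ
  have hdiff : Differentiable ℂ h := by
    intro z₀
    by_cases hz₀ : z₀ ∈ Ω
    · refine DifferentiableAt.congr_of_eventuallyEq ?_
        (eventually_of_mem (hΩ.mem_nhds hz₀) hhΩ)
      obtain ⟨r, hr, hrΩ⟩ := nhds_basis_closedBall.mem_iff.1 (hΩ.mem_nhds hz₀)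
      obtain ⟨M, hM⟩ := (isCompact_closedBall z₀ r).exists_bound_of_continuousOn
        (hf.continuousOn.mono hrΩ)
      have hsub : ball z₀ (r / 2) ⊆ Ω :=
        (ball_subset_closedBall.trans (closedBall_subset_closedBall (by linarith))).trans hrΩ
      have hsub' : ∀ z ∈ ball z₀ (r / 2), ball z (r / 2) ⊆ closedBall z₀ r := fun z hz =>
        (ball_subset_ball' (by rw [mem_ball] at hz; linarith)).trans ball_subset_closedBall
      -- The kernel bound has two cases. If w is within r/2 of z, the Schwarz lemma bounds the
      -- divided difference by 2M / (r/2); otherwise the denominator is at least r/2 and the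
      -- numerator at most C + M.
      refine hΓ.differentiableAt_contourIntegral (half_pos hr)
        (M := max ((M + M) / (r / 2)) ((C + M) / (r / 2))) ?_ ?_ ?_
      · intro w hw
        simp only [dslope_comm f _ w]
        exact ((Complex.differentiableOn_dslope (hΩ.mem_nhds (htr hw))).2 hf).mono hsub
      · intro z hz
        exact ((Complex.differentiableOn_dslope (hΩ.mem_nhds (hsub hz))).2
          hf).continuousOn.mono htr
      · intro z hz w hw
        have hzM : ‖f z‖ ≤ M := hM z (hsub' z hz (mem_ball_self (half_pos hr)))
        by_cases hwz : w ∈ ball z (r / 2)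
        · refine le_max_of_le_left (Complex.norm_dslope_le_div_of_mapsTo_ball
            (hf.mono ((hsub' z hz).trans hrΩ)) (fun y hy => ?_) hwz)
          rw [mem_closedBall, dist_eq_norm]
          exact (norm_sub_le _ _).trans (add_le_add (hM y (hsub' z hz hy)) hzM)
        · refine le_max_of_le_right ?_
          rw [mem_ball, not_lt] at hwz
          have hwne : w ≠ z := fun h => by
            rw [h, dist_self] at hwz; linarith
          rw [dslope_of_ne f hwne, slope_def_module, norm_smul, norm_inv, ← div_eq_inv_mul,
            ← dist_eq_norm w z]
          have hCM : ‖f w - f z‖ ≤ C + M :=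
            (norm_sub_le _ _).trans (add_le_add (hC w hw) hzM)
          exact div_le_div₀ ((norm_nonneg _).trans hCM) hCM (half_pos hr) hwz
    · have hzW := hΩW z₀ hz₀
      refine DifferentiableAt.congr_of_eventuallyEq ?_
        (eventually_of_mem (hW.mem_nhds hzW) hhW)
      obtain ⟨r, hr, hrW⟩ := nhds_basis_ball.mem_iff.1 (hW.mem_nhds hzW)
      have hsub : ball z₀ (r / 2) ⊆ W := (ball_subset_ball (by linarith)).trans hrW
      -- The ball of radius r about z₀ misses the curves, so points of the half ball keep distance
      -- at least r/2 from them.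
      refine hΓ.differentiableAt_contourIntegral (half_pos hr) (M := (r / 2)⁻¹ * C) ?_ ?_ ?_
      · intro w hw
        refine DifferentiableOn.smul_const (DifferentiableOn.inv (by fun_prop) fun z hz => ?_) _
        exact hne z (hsub hz) w hw
      · exact fun z hz => hcauchy z (hsub hz)
      · intro z hz w hw
        have hdist : r / 2 ≤ ‖w - z‖ := by
          have h1 : r ≤ dist w z₀ := by
            by_contra! hlt
            exact disjoint_left.1 hWtr (hrW hlt) hw
          have h2 := dist_triangle w z z₀
          rw [mem_ball] at hz
          rw [← dist_eq_norm]; linarith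
        rw [norm_smul, norm_inv]
        exact mul_le_mul (inv_anti₀ (half_pos hr) hdist) (hC w hw) (norm_nonneg _)
          (by positivity)
  obtain ⟨R, hR⟩ := hcK.isBounded.exists_norm_le
  -- Near infinity h is the Cauchy-type integral, which decays like 1 / (‖z‖ - R). Liouville's
  -- theorem then forces h = 0.
  have hlim : Tendsto h (cocompact ℂ) (𝓝 0) := by
    have hnorm : Tendsto (fun z : ℂ => ‖z‖) (cocompact ℂ) atTop := tendsto_norm_cocompact_atTop
    have hW' : ∀ᶠ z in cocompact ℂ, z ∈ W := by
      rw [← Metric.cobounded_eq_cocompact]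
      exact Bornology.isBounded_compl_iff.1 hWb
    have hb : Tendsto (fun z : ℂ => length Γ * ((‖z‖ - R)⁻¹ * C)) (cocompact ℂ) (𝓝 0) := by
      have := ((tendsto_inv_atTop_zero.comp
        (tendsto_atTop_add_const_right _ (-R) hnorm)).mul_const C).const_mul (length Γ)
      simpa [Function.comp_def, sub_eq_add_neg] using this
    refine squeeze_zero_norm' ?_ hb
    filter_upwards [hW', hnorm.eventually_gt_atTop R] with z hz hzR
    rw [hhW z hz]
    refine hΓ.norm_contourIntegral_le fun w hw => ?_
    rw [norm_smul, norm_inv]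
    have h1 : ‖z‖ - R ≤ ‖w - z‖ := by
      have := norm_sub_norm_le z w
      rw [norm_sub_rev] at this
      linarith [hR w hw]
    exact mul_le_mul (inv_anti₀ (sub_pos.2 hzR) h1) (hC w hw) (norm_nonneg _)
      (inv_nonneg.2 (sub_pos.2 hzR).le)
  rw [← hhW z hz]
  exact hdiff.apply_eq_of_tendsto_cocompact z hlim

/-- **Cauchy's integral theorem, homology version**. -/
theorem IsRectifiable.contourIntegral_eq_zero [CompleteSpace E] {Γ : Fin m → ℝ → ℂ}
    (hΓ : IsRectifiable Γ) {Ω W : Set ℂ} (hΩ : IsOpen Ω) (hW : IsOpen W)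
    (hΩW : ∀ z, z ∉ Ω → z ∈ W) (hWb : Bornology.IsBounded Wᶜ) (htr : trace Γ ⊆ Ω)
    (hWtr : Disjoint W (trace Γ)) (hwind : ∀ z ∈ W, windingNumber Γ z = 0)
    {f : ℂ → E} (hf : DifferentiableOn ℂ f Ω) : contourIntegral Γ f = 0 := by
  obtain ⟨z, hz⟩ : W.Nonempty := by
    by_contra hne
    rw [not_nonempty_iff_eq_empty.1 hne, compl_empty] at hWb
    exact NormedSpace.unbounded_univ ℂ ℂ hWb
  -- Multiplying f by w - z cancels the Cauchy kernel, so the vanishing integral is that of f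
  -- itself.
  rw [← hΓ.contourIntegral_inv_sub_smul_eq_zero hΩ hW hΩW hWb htr hWtr hwind
    (f := fun w => (w - z) • f w) (DifferentiableOn.smul (by fun_prop) hf) hz]
  refine contourIntegral_congr fun w hw => ?_
  have : w - z ≠ 0 := fun h => disjoint_left.1 hWtr hz (sub_eq_zero.1 h ▸ hw)
  simp only [inv_smul_smul₀ this]

end Cauchy

/-! ### Reflection of contours in the real axis. -/

section Conjugation

variable {E E' : Type*} [NormedAddCommGroup E] [NormedSpace ℂ E] [CompleteSpace E]
  [NormedAddCommGroup E'] [NormedSpace ℂ E'] [CompleteSpace E'] {m : ℕ}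

theorem IsRectifiable.map_contourIntegral {Γ : Fin m → ℝ → ℂ} (hΓ : IsRectifiable Γ)
    (L : E →L[ℂ] E') {g : ℂ → E} (hg : ContinuousOn g (trace Γ)) :
    L (contourIntegral Γ g) = contourIntegral Γ fun w => L (g w) := by
  simp only [contourIntegral, map_sum]
  refine Finset.sum_congr rfl fun j _ => ?_
  rw [← L.intervalIntegral_comp_comm (hΓ.intervalIntegrable hg j)]
  simp only [map_smul]

/-- The family of complex conjugate curves. -/
def conjCurves (Γ : Fin m → ℝ → ℂ) : Fin m → ℝ → ℂ := fun j t => starRingEnd ℂ (Γ j t)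

theorem deriv_conjCurves (Γ : Fin m → ℝ → ℂ) (j : Fin m) :
    deriv (conjCurves Γ j) = fun t => starRingEnd ℂ (deriv (Γ j) t) :=
  deriv.star' (f := Γ j)

theorem conj_mem_trace_of_mem_trace_conjCurves {Γ : Fin m → ℝ → ℂ} {w : ℂ}
    (hw : w ∈ trace (conjCurves Γ)) : starRingEnd ℂ w ∈ trace Γ := by
  obtain ⟨j, t, ht, rfl⟩ := mem_iUnion.1 hw
  simpa [conjCurves] using mem_trace Γ j ht

theorem IsRectifiable.conjCurves {Γ : Fin m → ℝ → ℂ} (hΓ : IsRectifiable Γ) :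
    IsRectifiable (conjCurves Γ) where
  continuousOn j := Complex.continuous_conj.comp_continuousOn (hΓ.continuousOn j)
  intervalIntegrable_deriv j := by
    rw [deriv_conjCurves]
    have h := hΓ.intervalIntegrable_deriv j
    exact ⟨Complex.conjCLE.toContinuousLinearMap.integrable_comp h.1,
      Complex.conjCLE.toContinuousLinearMap.integrable_comp h.2⟩

/-- A conjugate-linear map takes an integral along `Γ` to an integral along the conjugate of
`Γ`. -/
theorem IsRectifiable.map_contourIntegral_conj {Γ : Fin m → ℝ → ℂ} (hΓ : IsRectifiable Γ)
    (L : E →SL[starRingEnd ℂ] E') {g : ℂ → E} (hg : ContinuousOn g (trace Γ)) :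
    L (contourIntegral Γ g) =
      contourIntegral (QuatCalc.conjCurves Γ) fun w => L (g (starRingEnd ℂ w)) := by
  -- Commuting with the integral over t needs only real linearity. Conjugate linearity then acts on
  -- the factor `deriv (Γ j) t`, giving the velocity of the reflected curve.
  let L' : E →L[ℝ] E' :=
    { toFun := L
      map_add' := map_add L
      map_smul' := fun r x => by
        rw [← Complex.coe_smul r x, map_smulₛₗ, Complex.conj_ofReal, Complex.coe_smul]; rfl
      cont := L.continuous }
  simp only [contourIntegral, map_sum]
  refine Finset.sum_congr rfl fun j _ => ?_
  have := L'.intervalIntegral_comp_comm (hΓ.intervalIntegrable hg j)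
  refine this.symm.trans ?_
  rw [deriv_conjCurves]
  simp only [QuatCalc.conjCurves, Complex.conj_conj]
  exact intervalIntegral.integral_congr fun t _ => map_smulₛₗ L _ _

/-- The sign comes from conjugating 2πi: reflection reverses orientation. -/
theorem IsRectifiable.windingNumber_conjCurves {Γ : Fin m → ℝ → ℂ} (hΓ : IsRectifiable Γ) {z : ℂ}
    (hz : starRingEnd ℂ z ∉ trace Γ) :
    windingNumber (QuatCalc.conjCurves Γ) z =
      -starRingEnd ℂ (windingNumber Γ (starRingEnd ℂ z)) := by
  have hc : ContinuousOn (fun w => (w - starRingEnd ℂ z)⁻¹) (trace Γ) :=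
    (continuousOn_id.sub continuousOn_const).inv₀ fun w hw h => hz <| by
      rwa [← show w = starRingEnd ℂ z from sub_eq_zero.1 h]
  have h := hΓ.map_contourIntegral_conj ((starL ℂ : ℂ ≃L⋆[ℂ] ℂ) : ℂ →SL[starRingEnd ℂ] ℂ) hc
  have h' : starRingEnd ℂ (contourIntegral Γ fun w => (w - starRingEnd ℂ z)⁻¹) =
      contourIntegral (QuatCalc.conjCurves Γ) fun w => (w - z)⁻¹ := by
    refine h.trans (contourIntegral_congr fun w _ => ?_)
    change starRingEnd ℂ _ = _
    simp
  simp only [windingNumber]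
  rw [← h']
  simp [map_ofNat (starRingEnd ℂ) 2]

theorem trace_append {n : ℕ} (Γ : Fin m → ℝ → ℂ) (Γ' : Fin n → ℝ → ℂ) :
    trace (Fin.append Γ Γ') ⊆ trace Γ ∪ trace Γ' := by
  refine iUnion_subset fun j => ?_
  rintro _ ⟨t, ht, rfl⟩
  refine Fin.addCases (fun i => ?_) (fun i => ?_) j
  · rw [Fin.append_left]; exact Or.inl (mem_trace Γ i ht)
  · rw [Fin.append_right]; exact Or.inr (mem_trace Γ' i ht)

theorem IsRectifiable.append {n : ℕ} {Γ : Fin m → ℝ → ℂ} {Γ' : Fin n → ℝ → ℂ}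
    (hΓ : IsRectifiable Γ) (hΓ' : IsRectifiable Γ') : IsRectifiable (Fin.append Γ Γ') where
  continuousOn j := by
    refine Fin.addCases (fun i => ?_) (fun i => ?_) j
    · rw [Fin.append_left]; exact hΓ.continuousOn i
    · rw [Fin.append_right]; exact hΓ'.continuousOn i
  intervalIntegrable_deriv j := by
    refine Fin.addCases (fun i => ?_) (fun i => ?_) j
    · rw [Fin.append_left]; exact hΓ.intervalIntegrable_deriv i
    · rw [Fin.append_right]; exact hΓ'.intervalIntegrable_deriv i

theorem IsCauchyDomain.isRectifiable {U Δ : Set ℂ} {Γ : Fin m → ℝ → ℂ}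
    (hΓ : IsCauchyDomain U Δ Γ) : IsRectifiable Γ where
  continuousOn j := (hΓ.isClosedPiecewiseC1 j).1
  intervalIntegrable_deriv j := (hΓ.isClosedPiecewiseC1 j).intervalIntegrable_deriv

/-- If `g` is holomorphic on `U \ K`, where `U` and `K` are conjugate symmetric and `K` lies in
the Cauchy domain `Δ`, then its integrals along the boundary of `Δ` and along the conjugate
boundary cancel. -/
theorem IsCauchyDomain.contourIntegral_add_conjCurves {U Δ K : Set ℂ} {Γ : Fin m → ℝ → ℂ}
    (hΓ : IsCauchyDomain U Δ Γ) (hU : IsOpen U) (hUconj : ∀ ζ ∈ U, starRingEnd ℂ ζ ∈ U)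
    (hK : IsClosed K) (hKconj : ∀ ζ ∈ K, starRingEnd ℂ ζ ∈ K) (hKΔ : K ⊆ Δ)
    {g : ℂ → E} (hg : DifferentiableOn ℂ g (U \ K)) :
    contourIntegral Γ g + contourIntegral (conjCurves Γ) g = 0 := by
  have hR := hΓ.isRectifiable
  have htr : trace Γ = frontier Δ := hΓ.frontier_eq.symm
  have hfrU : frontier Δ ⊆ U := frontier_subset_closure.trans hΓ.closure_subset
  have hfrΔ : ∀ w ∈ frontier Δ, w ∉ Δ := fun w hw => by
    rw [hΓ.isOpen.frontier_eq] at hw; exact hw.2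
  have hall : ∀ w ∈ trace (Fin.append Γ (conjCurves Γ)),
      w ∈ frontier Δ ∨ starRingEnd ℂ w ∈ frontier Δ := fun w hw =>
    (trace_append _ _ hw).imp (fun h => htr ▸ h)
      fun h => htr ▸ conj_mem_trace_of_mem_trace_conjCurves h
  -- The points inside both Δ and its mirror image, or outside both closures. The two winding
  -- numbers cancel in the first case and both vanish in the second. A point of Δ whose mirror image
  -- leaves Δ needs no control: it lies in U \ K.
  let W : Set ℂ := (Δ ∩ starRingEnd ℂ ⁻¹' Δ) ∪
    ((closure Δ)ᶜ ∩ starRingEnd ℂ ⁻¹' (closure Δ)ᶜ)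
  have hW : IsOpen W :=
    (hΓ.isOpen.inter (hΓ.isOpen.preimage Complex.continuous_conj)).union
      (isClosed_closure.isOpen_compl.inter
        (isClosed_closure.isOpen_compl.preimage Complex.continuous_conj))
  rw [← contourIntegral_append]
  refine (hR.append hR.conjCurves).contourIntegral_eq_zero (hU.sdiff hK) hW ?_ ?_ ?_ ?_ ?_ hg
  · intro z hz
    -- By symmetry of K and U, a point of K is inside both domains and a point off U is outside both
    -- closures.
    by_cases hzU : z ∈ U
    · have hzK : z ∈ K := by_contra fun h => hz ⟨hzU, h⟩
      exact Or.inl ⟨hKΔ hzK, hKΔ (hKconj z hzK)⟩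
    · refine Or.inr ⟨fun h => hzU (hΓ.closure_subset h), fun h => hzU ?_⟩
      simpa using hUconj _ (hΓ.closure_subset h)
  · obtain ⟨R, hRb⟩ := hΓ.isBounded.closure.exists_norm_le
    refine isBounded_iff_forall_norm_le.2 ⟨R, fun z hz => ?_⟩
    by_contra hlt
    refine hz (Or.inr ⟨fun h => hlt (hRb z h), fun h => hlt ?_⟩)
    simpa using hRb _ h
  · intro w hw
    rcases hall w hw with h | h
    · exact ⟨hfrU h, fun hk => hfrΔ w h (hKΔ hk)⟩
    · exact ⟨by simpa using hUconj _ (hfrU h), fun hk => hfrΔ _ h (hKΔ (hKconj w hk))⟩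
  · rw [disjoint_left]
    rintro w (⟨h1, h2⟩ | ⟨h1, h2⟩) hw
    · exact (hall w hw).elim (fun h => hfrΔ w h h1) fun h => hfrΔ _ h h2
    · exact (hall w hw).elim (fun h => h1 (frontier_subset_closure h))
        fun h => h2 (frontier_subset_closure h)
  · intro z hz
    have hztr : starRingEnd ℂ z ∉ trace Γ := by
      rw [htr]
      intro h
      rcases hz with ⟨-, h2⟩ | ⟨-, h2⟩
      · exact hfrΔ _ h h2
      · exact h2 (frontier_subset_closure h)
    have hadd : windingNumber (Fin.append Γ (conjCurves Γ)) z =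
        windingNumber Γ z + windingNumber (conjCurves Γ) z := by
      simp only [windingNumber, contourIntegral_append, mul_add]
    rw [hadd, hR.windingNumber_conjCurves hztr]
    rcases hz with ⟨h1, h2⟩ | ⟨h1, h2⟩
    · rw [hΓ.winding_inside _ h1, hΓ.winding_inside _ h2]; simp
    · rw [hΓ.winding_outside _ h1, hΓ.winding_outside _ h2]; simp

end Conjugation

/-! ### The conjugation `flat` and the symmetry of the resolvent. -/

section Flat

variable {V : Type*} [NormedAddCommGroup V] [NormedSpace ℝ V]

theorem Complexification.conj_conj (z : Complexification V) :
    Complexification.conj (Complexification.conj z) = z := by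
  ext <;> simp

theorem Complexification.norm_conj_le (z : Complexification V) :
    ‖Complexification.conj z‖ ≤ ‖z‖ := by
  refine ContinuousLinearMap.opNorm_le_bound (Complexification.conj z).toCLM (norm_nonneg z)
    fun w => ?_
  have h := z.toCLM.le_opNorm (starRingEnd ℂ w)
  rw [RCLike.norm_conj] at h
  simpa [Complexification.norm_def] using h

/-- `S ↦ S♭` as a ring homomorphism. -/
noncomputable def flatHom : (Complexification V →L[ℂ] Complexification V) →+*
    (Complexification V →L[ℂ] Complexification V) where
  toFun := flat
  map_one' := ContinuousLinearMap.ext fun z => Complexification.conj_conj z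
  map_mul' A B := ContinuousLinearMap.ext fun z => by
    change Complexification.conj (A (B _)) = Complexification.conj (A
      (Complexification.conj (Complexification.conj (B _))))
    rw [Complexification.conj_conj]
  map_zero' := ContinuousLinearMap.ext fun z => map_zero Complexification.conj
  map_add' A B := ContinuousLinearMap.ext fun z => map_add Complexification.conj _ _

theorem flat_smul (c : ℂ) (A : Complexification V →L[ℂ] Complexification V) :
    flat (c • A) = starRingEnd ℂ c • flat A :=
  ContinuousLinearMap.ext fun _ => map_smulₛₗ Complexification.conj _ _

/-- `S ↦ S♭` as a continuous conjugate-linear map. -/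
noncomputable def flatL : (Complexification V →L[ℂ] Complexification V) →SL[starRingEnd ℂ]
    (Complexification V →L[ℂ] Complexification V) :=
  LinearMap.mkContinuous
    { toFun := flat
      map_add' := map_add flatHom
      map_smul' := flat_smul } 1 fun A => by
    rw [one_mul]
    refine ContinuousLinearMap.opNorm_le_bound _ (norm_nonneg A) fun z => ?_
    refine (Complexification.norm_conj_le _).trans ((A.le_opNorm _).trans ?_)
    exact mul_le_mul_of_nonneg_left (Complexification.norm_conj_le z) (norm_nonneg A)

theorem flat_algebraMap_sub_complexify (T : V →L[ℝ] V) (ζ : ℂ) :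
    flat (algebraMap ℂ _ ζ - complexify T) =
      algebraMap ℂ _ (starRingEnd ℂ ζ) - complexify T := by
  have h1 : flat (algebraMap ℂ (Complexification V →L[ℂ] Complexification V) ζ) =
      algebraMap ℂ _ (starRingEnd ℂ ζ) := by
    rw [Algebra.algebraMap_eq_smul_one, flat_smul, Algebra.algebraMap_eq_smul_one]
    congr 1
    exact map_one flatHom
  have h2 : flat (complexify T) = complexify T :=
    ContinuousLinearMap.ext fun z => by
      change Complexification.conj (complexify T (Complexification.conj z)) = _
      ext <;> simp
  have h3 := map_sub flatHom (algebraMap ℂ (Complexification V →L[ℂ] Complexification V) ζ)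
    (complexify T)
  exact h3.trans (congrArg₂ _ h1 h2)

/-- The ring homomorphism `flatHom` preserves units and carries ζ - T_ℂ to its counterpart at the
conjugate point. -/
theorem conj_mem_resolventSet_complexify (T : V →L[ℝ] V) {ζ : ℂ}
    (hζ : ζ ∈ resolventSet ℂ (complexify T)) :
    starRingEnd ℂ ζ ∈ resolventSet ℂ (complexify T) := by
  rw [spectrum.mem_resolventSet_iff] at hζ ⊢
  rw [← flat_algebraMap_sub_complexify]
  exact hζ.map flatHom

theorem flat_resolvent_complexify (T : V →L[ℝ] V) {ζ : ℂ}
    (hζ : ζ ∈ resolventSet ℂ (complexify T)) :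
    flat (resolvent (complexify T) ζ) = resolvent (complexify T) (starRingEnd ℂ ζ) := by
  have hu := spectrum.mem_resolventSet_iff.1 hζ
  have hu' := spectrum.mem_resolventSet_iff.1 (conj_mem_resolventSet_complexify T hζ)
  have h := congrArg flatHom (Ring.inverse_mul_cancel _ hu)
  rw [map_mul, map_one] at h
  have h' : flat (resolvent (complexify T) ζ) *
      (algebraMap ℂ _ (starRingEnd ℂ ζ) - complexify T) = 1 := by
    rw [← flat_algebraMap_sub_complexify]; exact h
  -- A left inverse of an invertible element equals its two-sided inverse.
  rw [← mul_one (flat _), ← Ring.mul_inverse_cancel _ hu', ← mul_assoc, h', one_mul]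
  rfl

theorem differentiableOn_mul_resolvent [CompleteSpace V]
    {F : ℂ → Complexification V →L[ℂ] Complexification V} {U : Set ℂ}
    (hF : DifferentiableOn ℂ F U) (S : Complexification V →L[ℂ] Complexification V) :
    DifferentiableOn ℂ (fun ζ => F ζ * resolvent S ζ) (U \ spectrum ℂ S) := by
  refine (hF.mono sdiff_subset).mul fun ζ hζ => ?_
  have h := spectrum.hasDerivAt_resolvent_const_left
    (spectrum.mem_resolventSet_iff.2 (spectrum.notMem_iff.1 hζ.2))
  exact h.differentiableAt.differentiableWithinAt

end Flat

/-! ### Stability of B^r(V_ℂ) under resolvents and integrals. -/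

section RightLinear

variable {V : Type*} [NormedAddCommGroup V] [NormedSpace ℝ V]
  [Module ℍ[ℝ] V] [Module ℍ[ℝ]ᵐᵒᵖ V] [BanachHSpace V]

/-- Right multiplication by q on V_ℂ is the complexification of a bounded operator on V. This turns
membership into commutation within the operator algebra, where inverses and integrals are easily
handled. -/
theorem exists_mem_rightLinearOpsC_iff_commute (V : Type*) [NormedAddCommGroup V]
    [NormedSpace ℝ V] [Module ℍ[ℝ] V] [Module ℍ[ℝ]ᵐᵒᵖ V] [BanachHSpace V] :
    ∃ R : ℍ[ℝ] → (Complexification V →L[ℂ] Complexification V),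
      ∀ S, S ∈ rightLinearOpsC V ↔ ∀ q, Commute S (R q) := by
  obtain ⟨R, -, hR⟩ := BanachHSpace.exists_rightMul (V := V)
  have h : ∀ q z, complexify (R q) z = z.rightMul q := fun q z => by
    simp [Complexification.rightMul, hR]
  refine ⟨fun q => complexify (R q), fun S => forall_congr' fun q => ?_⟩
  rw [Commute, SemiconjBy, ContinuousLinearMap.ext_iff]
  refine forall_congr' fun z => ?_
  rw [mul_apply_eq_comp, mul_apply_eq_comp, h, h]

theorem complexify_mem_rightLinearOpsC (T : rightLinearOps V) :
    complexify (T : V →L[ℝ] V) ∈ rightLinearOpsC V := fun q z => by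
  ext <;> simp [Complexification.rightMul, T.2 q]

theorem commute_ringInverse_left {A : Type*} [Ring A] {a b : A} (h : Commute a b) :
    Commute (Ring.inverse a) b := by
  by_cases ha : IsUnit a
  · obtain ⟨u, rfl⟩ := ha
    rw [Ring.inverse_unit]
    exact h.units_inv_left
  · rw [Ring.inverse_non_unit _ ha]
    exact Commute.zero_left b

theorem resolvent_mem_rightLinearOpsC {S : Complexification V →L[ℂ] Complexification V}
    (hS : S ∈ rightLinearOpsC V) (ζ : ℂ) : resolvent S ζ ∈ rightLinearOpsC V := by
  obtain ⟨R, hR⟩ := exists_mem_rightLinearOpsC_iff_commute V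
  have h := (hR _).1 (sub_mem (algebraMap_mem (rightLinearOpsC V) ζ) hS)
  exact (hR _).2 fun q => commute_ringInverse_left (h q)

/-- Left and right multiplication by a fixed operator are bounded linear maps, so they pass under
the integral, where commutation holds pointwise. -/
theorem IsRectifiable.contourIntegral_mem_rightLinearOpsC [CompleteSpace V] {m : ℕ}
    {Γ : Fin m → ℝ → ℂ} (hΓ : IsRectifiable Γ)
    {g : ℂ → Complexification V →L[ℂ] Complexification V} (hg : ContinuousOn g (trace Γ))
    (hmem : ∀ w ∈ trace Γ, g w ∈ rightLinearOpsC V) :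
    contourIntegral Γ g ∈ rightLinearOpsC V := by
  obtain ⟨R, hR⟩ := exists_mem_rightLinearOpsC_iff_commute V
  refine (hR _).2 fun q => ?_
  let μ := ContinuousLinearMap.mul ℂ (Complexification V →L[ℂ] Complexification V)
  have h1 : contourIntegral Γ g * R q = contourIntegral Γ fun w => g w * R q :=
    hΓ.map_contourIntegral (μ.flip (R q)) hg
  have h2 : R q * contourIntegral Γ g = contourIntegral Γ fun w => R q * g w :=
    hΓ.map_contourIntegral (μ (R q)) hg
  rw [Commute, SemiconjBy, h1, h2]
  exact contourIntegral_congr fun w hw => (hR _).1 (hmem w hw) q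

end RightLinear

end QuatCalc

/-! ### The main theorem. -/

theorem theorem4p1 {V : Type*} [NormedAddCommGroup V] [NormedSpace ℝ V] [CompleteSpace V]
    [Module ℍ[ℝ] V] [Module ℍ[ℝ]ᵐᵒᵖ V] [QuatCalc.BanachHSpace V]
    (U : Set ℂ) (hU : IsOpen U) (hUconj : ∀ ζ ∈ U, starRingEnd ℂ ζ ∈ U)
    (F : ℂ → QuatCalc.Complexification V →L[ℂ] QuatCalc.Complexification V)
    (hFmem : ∀ ζ ∈ U, F ζ ∈ QuatCalc.rightLinearOpsC V)
    (hF : AnalyticOnNhd ℂ F U)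
    (hFconj : ∀ ζ ∈ U, QuatCalc.flat (F ζ) = F (starRingEnd ℂ ζ))
    (T : QuatCalc.rightLinearOps V) (hT : QuatCalc.complexSpectrum T ⊆ U)
    (Δ : Set ℂ) (m : ℕ) (Γ : Fin m → ℝ → ℂ) (hΓ : QuatCalc.IsCauchyDomain U Δ Γ)
    (hΔ : spectrum ℂ (QuatCalc.complexify (T : V →L[ℝ] V)) ⊆ Δ) :
    QuatCalc.rieszDunford Γ F (QuatCalc.complexify (T : V →L[ℝ] V)) ∈
        QuatCalc.rightLinearOpsC V ∧
      QuatCalc.flat (QuatCalc.rieszDunford Γ F (QuatCalc.complexify (T : V →L[ℝ] V))) =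
        QuatCalc.rieszDunford Γ F (QuatCalc.complexify (T : V →L[ℝ] V)) := by
  open QuatCalc in
  have hR := hΓ.isRectifiable
  set S := complexify (T : V →L[ℝ] V) with hS
  -- The boundary of the open set Δ is disjoint from Δ, hence from the spectrum.
  have htr : trace Γ ⊆ U \ spectrum ℂ S := fun w hw => by
    have hw' : w ∈ frontier Δ := hΓ.frontier_eq.symm ▸ hw
    refine ⟨hΓ.closure_subset (frontier_subset_closure hw'), fun hs => ?_⟩
    rw [hΓ.isOpen.frontier_eq] at hw'
    exact hw'.2 (hΔ hs)
  have hd := differentiableOn_mul_resolvent hF.differentiableOn S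
  have hc : ContinuousOn (fun ζ => F ζ * resolvent S ζ) (trace Γ) := hd.continuousOn.mono htr
  refine ⟨Subalgebra.smul_mem _ (hR.contourIntegral_mem_rightLinearOpsC hc fun w hw =>
    mul_mem (hFmem w (htr hw).1)
      (resolvent_mem_rightLinearOpsC (complexify_mem_rightLinearOpsC T) w)) _, ?_⟩
  have hres : ∀ ζ, ζ ∉ spectrum ℂ S → ζ ∈ resolventSet ℂ S := fun ζ h => not_not.1 h
  have hsymm : ∀ ζ ∈ spectrum ℂ S, starRingEnd ℂ ζ ∈ spectrum ℂ S := fun ζ hζ h => hζ <| by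
    simpa using conj_mem_resolventSet_complexify (T : V →L[ℝ] V) h
  have hzero := hΓ.contourIntegral_add_conjCurves hU hUconj (spectrum.isClosed S) hsymm hΔ hd
  have hconj : flat (contourIntegral Γ fun ζ => F ζ * resolvent S ζ) =
      contourIntegral (conjCurves Γ) fun ζ => F ζ * resolvent S ζ := by
    refine (hR.map_contourIntegral_conj flatL hc).trans (contourIntegral_congr fun w hw => ?_)
    have hw' := htr (conj_mem_trace_of_mem_trace_conjCurves hw)
    refine (map_mul flatHom _ _).trans (congrArg₂ _ ?_ ?_)
    · exact (hFconj _ hw'.1).trans (by rw [Complex.conj_conj])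
    · exact (flat_resolvent_complexify (T : V →L[ℝ] V) (hres _ hw'.2)).trans
        (by rw [Complex.conj_conj])
  -- Two signs cancel: one from conjugating (2πi)⁻¹, the other from replacing the integral over the
  -- reflected curves by minus the integral over Γ.
  rw [rieszDunford, flat_smul, hconj, ← neg_eq_of_add_eq_zero_right hzero, smul_neg, ← neg_smul]
  congr 1
  simp [map_ofNat (starRingEnd ℂ) 2]
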